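/- Let $(E;\oplus,0,1)$ be an effect algebra, with orthosupplement $a^\perp$ (the unique element such that $a\oplus a^\perp=1$) and order $a\le b\iff a\oplus c=b$ for some $c\in E$. Suppose that $E$ is convex and sequential. Convex means that scalar multiples $\lambda a\in E$ ($\lambda\in[0,1]$, $a\in E$) are given such that $\mu(\lambda a)=(\lambda\mu)a$; $(\lambda+\mu)a=\lambda a\oplus\mu a$ (the sum being defined) if $\lambda+\mu\le 1$; $\lambda(a\oplus b)=\lambda a\oplus\lambda b$ (the sum on the right being defined) if $a\oplus b$ is defined; and $1a=a$. Sequential means that a product $\circ:E\times E\to E$ is given such that, writing $a|b$ for $a\circ b=b\circ a$: $a\circ(b\oplus c)=a\circ b\oplus a\circ c$ (the sum on the right being defined) whenever $b\oplus c$ is defined; $1\circ a=a$; $a\circ b=0$ implies $b\circ a=0$; if $a|b$ then $a|b^\perp$ and $a\circ(b\circ c)=(a\circ b)\circ c$ for all $c$; if $c|a$ and $c|b$ then $c|(a\circ b)$ and, if $a\oplus b$ is defined, $c|(a\oplus b)$. An element $a$ is sharp if $x\le a$ and $x\le a^\perp$ imply $x=0$; it is one-dimensional if every $b\le a$ is of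 the form $b=ta$ with $t\in[0,1]$. A context is a finite family $p_1,\dots,p_n$ of one-dimensional sharp elements with $p_1\oplus\dots\oplus p_n=1$. Assume that $E$ is context-spectral: every $a\in E$ has the form $a=\mu_1p_1\oplus\dots\oplus\mu_np_n$ for some context $(p_i)$ and some $\mu_i\in[0,1]$. Let $P$ be the set of sharp elements of $E$ and $J_p(a)=p\circ a$ for $p\in P$, $a\in E$. Then $(J_p)_{p\in P}$ is a compression base and $E$ with this compression base is spectral, i.e. it has the projection cover property and the b-comparability property. Explicitly: 1. (Compression base.) $P$ contains $0,1$ and is closed under $\perp$ and under defined sums $\oplus$; if $e\oplus f\oplus d$ is defined in $E$ and $e\oplus d,f\oplus d\in P$, then $d\in P$. For $p\in P$, the map $J_p$ is additive, $J_p(1)=p$, $J_p(a)=a$ for all $a\le p$, and $J_p(a)=0\iff a\le p^\perp$. If $p,q,r\in P$ and $p\oplus q\oplus r$ is defined, then $J_{p\oplus q}J_{q\oplus r}=J_q$. 2. (Projection cover property.) For each $a\in E$ there is $p\in P$ such that for all $q\in P$, $a\le q\iff p\le q$. 3. (b-comparability.) For $p\in P$ put $C(p)=\{a\in E: a=J_p(a)\oplus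 J_{p^\perp}(a)\}$, and for $A\subseteq E$ put $PC(A)=\{p\in P: A\subseteq C(p)\}$ and $P(A)=PC(PC(A)\cup A)$. (a) For each $a\in E$ there is a Boolean subalgebra $B\subseteq P$ (a subset containing $0,1$, closed under $\perp$ and under defined sums $\oplus$, which is a Boolean algebra in the inherited order with complementation $\perp$) such that for all $p\in P$, $a\in C(p)\iff B\subseteq C(p)$. (b) Let $e,f\in E$ be such that each $x\in P(\{e\})$ is compatible with each $y\in P(\{f\})$, that is, $x=x_1\oplus c$ and $y=y_1\oplus c$ for some $x_1,y_1,c\in E$ such that $x_1\oplus y_1\oplus c$ is defined. Then there is $p\in P(\{e,f\})$ with $J_p(e)\le J_p(f)$ and $J_{p^\perp}(f)\le J_{p^\perp}(e)$. -/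

import Mathlib

/-- An effect algebra. The partial operation is given by its domain `Orth` (orthogonality) and
a function `oplus`, whose values are meaningful only on orthogonal pairs; every use
of `oplus a b` below is accompanied by `Orth a b`. The orthosupplement of `a` is `aᶜ`. -/
class EffectAlgebra (E : Type*) extends Zero E, One E, Compl E where
  Orth : E → E → Prop
  oplus : E → E → E
  orth_comm : ∀ a b : E, Orth a b → Orth b a ∧ oplus a b = oplus b a
  orth_assoc : ∀ a b c : E, Orth a b → Orth (oplus a b) c →
    Orth b c ∧ Orth a (oplus b c) ∧ oplus (oplus a b) c = oplus a (oplus b c)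
  orth_compl : ∀ a : E, Orth a aᶜ ∧ oplus a aᶜ = 1
  compl_unique : ∀ a b : E, Orth a b → oplus a b = 1 → b = aᶜ
  eq_zero_of_orth_one : ∀ a : E, Orth a 1 → a = 0

namespace EffectAlgebra

section Basic

variable {E : Type*} [EffectAlgebra E]

/-- The order of an effect algebra: `a ≤ b` if `a ⊕ c = b` for some `c`. -/
instance instLE : LE E := ⟨fun a b => ∃ c : E, Orth a c ∧ oplus a c = b⟩

/-- `IsOrthosum l s`: the iterated sum of the list `l` is defined and equals `s`. -/
inductive IsOrthosum : List E → E → Prop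
  | nil : IsOrthosum [] 0
  | cons (a s : E) (l : List E) : IsOrthosum l s → Orth a s → IsOrthosum (a :: l) (oplus a s)

/-- `a` is sharp if the infimum of `a` and `aᶜ` is `0`. -/
def IsSharp (a : E) : Prop := ∀ x : E, x ≤ a → x ≤ aᶜ → x = 0

/-- Mackey compatibility. -/
def Compatible (a b : E) : Prop :=
  ∃ a₁ b₁ c : E, Orth a₁ b₁ ∧ Orth (oplus a₁ b₁) c ∧
    (Orth a₁ c ∧ a = oplus a₁ c) ∧ (Orth b₁ c ∧ b = oplus b₁ c)

/-- Additive maps of an effect algebra into itself. -/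
def IsAdditive (J : E → E) : Prop :=
  ∀ a b : E, Orth a b → Orth (J a) (J b) ∧ J (oplus a b) = oplus (J a) (J b)

/-- A retraction; its focus is `J 1`. -/
structure IsRetraction (J : E → E) : Prop where
  additive : IsAdditive J
  fixes : ∀ a : E, a ≤ J 1 → J a = a

/-- A compression. -/
structure IsCompression (J : E → E) : Prop extends IsRetraction J where
  eq_zero_iff : ∀ a : E, J a = 0 ↔ a ≤ (J 1)ᶜ

/-- Sub-effect algebras. -/
structure IsSubEffectAlgebra (P : Set E) : Prop where
  zero_mem : (0 : E) ∈ P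
  one_mem : (1 : E) ∈ P
  compl_mem : ∀ a ∈ P, aᶜ ∈ P
  oplus_mem : ∀ a ∈ P, ∀ b ∈ P, Orth a b → oplus a b ∈ P

/-- Normality of a subset: if `e ⊕ f ⊕ d` exists and `e ⊕ d`, `f ⊕ d` belong to the subset,
so does `d`. -/
def IsNormal (P : Set E) : Prop :=
  ∀ e f d : E, Orth e f → Orth (oplus e f) d → oplus e d ∈ P → oplus f d ∈ P → d ∈ P

/-- The family `(J p)`, `p ∈ P`, is a compression base with set of projections `P`
(the values `J p` for `p ∉ P` are irrelevant). -/
structure IsCompressionBase (P : Set E) (J : E → E → E) : Prop where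
  sub : IsSubEffectAlgebra P
  compression : ∀ p ∈ P, IsCompression (J p)
  focus : ∀ p ∈ P, J p 1 = p
  normal : IsNormal P
  comp : ∀ p ∈ P, ∀ q ∈ P, ∀ r ∈ P, Orth p q → Orth (oplus p q) r →
    ∀ a : E, J (oplus p q) (J (oplus q r) a) = J q a

/-- The commutant `C(p)` of a projection `p`: all `a` with `a = J_p(a) ⊕ J_{pᶜ}(a)`. -/
def commutant (J : E → E → E) (p : E) : Set E :=
  {a | Orth (J p a) (J pᶜ a) ∧ a = oplus (J p a) (J pᶜ a)}

/-- `PC(A)`: the projections `p` such that `A ⊆ C(p)`. -/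
def projCommutant (P : Set E) (J : E → E → E) (A : Set E) : Set E :=
  {p | p ∈ P ∧ ∀ a ∈ A, a ∈ commutant J p}

/-- The P-bicommutant `P(A) = PC(PC(A) ∪ A)`. -/
def bicommutant (P : Set E) (J : E → E → E) (A : Set E) : Set E :=
  projCommutant P J (projCommutant P J A ∪ A)

/-- `p` is a projection cover of `a`. -/
def IsProjectionCover (P : Set E) (a p : E) : Prop :=
  p ∈ P ∧ ∀ q ∈ P, a ≤ q ↔ p ≤ q

/-- The projection cover property. -/
def HasProjectionCoverProperty (P : Set E) : Prop :=
  ∀ a : E, ∃ p : E, IsProjectionCover P a p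

/-- `B` is a Boolean subalgebra of `P`: a sub-effect algebra contained in `P` which is a Boolean
algebra in the order and with the complementation inherited from the effect algebra. -/
def IsBooleanSubalgebra (P B : Set E) : Prop :=
  B ⊆ P ∧ IsSubEffectAlgebra B ∧
    ∃ inst : BooleanAlgebra B,
      (∀ x y : B, inst.le x y ↔ (x : E) ≤ (y : E)) ∧ ∀ x : B, (inst.compl x : E) = (x : E)ᶜ

/-- `a` has the b-property. -/
def IsBElement (P : Set E) (J : E → E → E) (a : E) : Prop :=
  ∃ B : Set E, IsBooleanSubalgebra P B ∧ ∀ p ∈ P, a ∈ commutant J p ↔ B ⊆ commutant J p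

/-- The relation `eCf`: every element of `P(e)` is compatible with every element of `P(f)`. -/
def Commute (P : Set E) (J : E → E → E) (e f : E) : Prop :=
  ∀ x ∈ bicommutant P J {e}, ∀ y ∈ bicommutant P J {f}, Compatible x y

/-- The b-comparability property. -/
structure HasBComparability (P : Set E) (J : E → E → E) : Prop where
  bElement : ∀ a : E, IsBElement P J a
  comparable : ∀ e f : E, Commute P J e f →
    {p | p ∈ bicommutant P J {e, f} ∧ J p e ≤ J p f ∧ J pᶜ f ≤ J pᶜ e}.Nonempty

/-- `(J p)`, `p ∈ P`, is a compression base and makes `E` a spectral effect algebra. -/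
structure IsSpectral (P : Set E) (J : E → E → E) : Prop where
  base : IsCompressionBase P J
  cover : HasProjectionCoverProperty P
  comparability : HasBComparability P J

end Basic

end EffectAlgebra

/-- A convex structure on an effect algebra: multiplication by scalars in `[0,1]`. -/
class ConvexEffectAlgebra (E : Type*) [EffectAlgebra E] where
  scale : unitInterval → E → E
  scale_scale : ∀ (l m : unitInterval) (a : E), scale m (scale l a) = scale (l * m) a
  scale_add : ∀ (l m k : unitInterval) (a : E), (l : ℝ) + (m : ℝ) = (k : ℝ) →
    EffectAlgebra.Orth (scale l a) (scale m a) ∧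
      scale k a = EffectAlgebra.oplus (scale l a) (scale m a)
  scale_oplus : ∀ (l : unitInterval) (a b : E), EffectAlgebra.Orth a b →
    EffectAlgebra.Orth (scale l a) (scale l b) ∧
      scale l (EffectAlgebra.oplus a b) = EffectAlgebra.oplus (scale l a) (scale l b)
  one_scale : ∀ a : E, scale 1 a = a

/-- A sequential product on an effect algebra. -/
class SequentialEffectAlgebra (E : Type*) [EffectAlgebra E] where
  seq : E → E → E
  seq_oplus : ∀ a b c : E, EffectAlgebra.Orth b c →
    EffectAlgebra.Orth (seq a b) (seq a c) ∧
      seq a (EffectAlgebra.oplus b c) = EffectAlgebra.oplus (seq a b) (seq a c)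
  one_seq : ∀ a : E, seq 1 a = a
  seq_zero_symm : ∀ a b : E, seq a b = 0 → seq b a = 0
  comm_compl : ∀ a b : E, seq a b = seq b a → seq a bᶜ = seq bᶜ a
  seq_assoc : ∀ a b : E, seq a b = seq b a → ∀ c : E, seq a (seq b c) = seq (seq a b) c
  comm_seq : ∀ a b c : E, seq c a = seq a c → seq c b = seq b c →
    seq c (seq a b) = seq (seq a b) c
  comm_oplus : ∀ a b c : E, seq c a = seq a c → seq c b = seq b c → EffectAlgebra.Orth a b →
    seq c (EffectAlgebra.oplus a b) = seq (EffectAlgebra.oplus a b) c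

namespace EffectAlgebra

section Contexts

variable {E : Type*} [EffectAlgebra E] [ConvexEffectAlgebra E]

/-- `a` is one-dimensional: every `b ≤ a` is a multiple of `a`. -/
def IsOneDimensional (a : E) : Prop :=
  ∀ b : E, b ≤ a → ∃ t : unitInterval, b = ConvexEffectAlgebra.scale t a

/-- A context: finitely many one-dimensional sharp elements whose sum is `1`. -/
structure IsContext {n : ℕ} (p : Fin n → E) : Prop where
  sharp : ∀ i, IsSharp (p i)
  oneDimensional : ∀ i, IsOneDimensional (p i)
  sum_eq_one : IsOrthosum (List.ofFn p) 1

variable (E) in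
/-- Every element has the form `⊕ μᵢ pᵢ` for a context `(pᵢ)` and scalars `μᵢ ∈ [0,1]`. -/
def IsContextSpectral : Prop :=
  ∀ a : E, ∃ (n : ℕ) (p : Fin n → E) (μ : Fin n → unitInterval),
    IsContext p ∧ IsOrthosum (List.ofFn fun i => ConvexEffectAlgebra.scale (μ i) (p i)) a

end Contexts

end EffectAlgebra

/-! A sharp `p` satisfies `p ∘ p = p` and `p ∘ pᶜ = 0`, so `p ∘ ·` fixes what lies below `p`, kills
exactly what lies below `pᶜ`, and `p` commutes with both kinds of elements. Hence `a ∈ C(p)` means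
that `p` and `a` commute in the sequential product (`IsSharp.mem_commutant_iff`), and all commutants
become sequential ones. The compression base axioms then follow from the fact that `e ⊕ d` and `f ⊕
d` have product `d` (`IsSharp.seq_eq_of_common`).

The spectral part rests on projection covers: the cover of `⊕ μᵢ pᵢ` is the sum of the `pᵢ` with `μᵢ
> 0`, and a sharp element commuting with `a` commutes with its cover. Peeling off the smallest
positive weight times the cover, again and again, shows that such an element commutes with each
level-set sum of `μ` (`IsSharpPartition.seqCommute_level`). So `a` is a combination of sharp
elements of its own bicommutant, and that bicommutant is the Boolean algebra required.

For comparability, the resolutions of `e` and `f` commute and have a common refinement `pᵢ ∘ rⱼ`;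
the projection sought is the sum of the cells with `μᵢ ≤ νⱼ`. -/

namespace EffectAlgebra

/-- The elements of `E` together with an additional value for undefined sums. -/
inductive Partial (E : Type*)
  | of : E → Partial E
  | undef : Partial E

@[simp]
theorem Partial.of_inj {E : Type*} {a b : E} : of a = of b ↔ a = b := by simp

open Partial

/-! ### Arithmetic of effect algebras through a total addition -/

section Arithmetic

variable {E : Type*} [EffectAlgebra E]

theorem orth_symm {a b : E} (h : Orth a b) : Orth b a := (orth_comm a b h).1

theorem oplus_comm {a b : E} (h : Orth a b) : oplus a b = oplus b a := (orth_comm a b h).2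

@[simp]
theorem compl_compl (a : E) : aᶜᶜ = a :=
  (compl_unique _ _ (orth_symm (orth_compl a).1)
    ((oplus_comm (orth_compl a).1).symm.trans (orth_compl a).2)).symm

@[simp]
theorem compl_one : (1 : E)ᶜ = 0 := eq_zero_of_orth_one _ (orth_symm (orth_compl 1).1)

@[simp]
theorem compl_zero : (0 : E)ᶜ = 1 := by rw [← compl_one, compl_compl]

theorem orth_zero_oplus (a : E) : Orth a 0 ∧ oplus a 0 = a := by
  have h1 := orth_compl a
  have h2 := orth_compl (1 : E)
  rw [compl_one] at h2
  have h3 : oplus aᶜ a = 1 := (oplus_comm h1.1).symm.trans h1.2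
  obtain ⟨h4, h5, h6⟩ := orth_assoc aᶜ a 0 (orth_symm h1.1) (by rw [h3]; exact h2.1)
  refine ⟨h4, ?_⟩
  rw [h3, h2.2] at h6
  simpa using compl_unique _ _ h5 h6.symm

open Classical in
/-- The total addition on `Partial E` extending the partial one of `E`. -/
noncomputable def Partial.add : Partial E → Partial E → Partial E
  | of a, of b => if Orth a b then of (oplus a b) else undef
  | _, _ => undef

noncomputable instance : Add (Partial E) := ⟨Partial.add⟩

instance : Zero (Partial E) := ⟨of 0⟩

namespace Partial

theorem of_zero : of (0 : E) = 0 := rfl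

theorem of_add_of {a b : E} (h : Orth a b) : of a + of b = of (oplus a b) := if_pos h

/-- A single equation carries both definedness and value, so sums can be rearranged as in a
commutative monoid without tracking domains. -/
theorem of_add_of_eq {a b c : E} : of a + of b = of c ↔ Orth a b ∧ oplus a b = c := by
  constructor
  · intro h
    by_cases hab : Orth a b
    · exact ⟨hab, of_inj.1 ((of_add_of hab).symm.trans h)⟩
    · have h' : of a + of b = undef := if_neg hab
      exact absurd (h'.symm.trans h) (by simp)
  · rintro ⟨h, rfl⟩
    exact of_add_of h

theorem undef_add (x : Partial E) : undef + x = undef := by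
  cases x <;> rfl

theorem add_undef (x : Partial E) : x + undef = undef := by
  cases x <;> rfl

theorem of_add_of_eq_undef {a b : E} (h : ¬ Orth a b) : of a + of b = undef := if_neg h

protected theorem add_comm (x y : Partial E) : x + y = y + x := by
  obtain a | _ := x
  swap
  · rw [undef_add, add_undef]
  obtain b | _ := y
  swap
  · rw [undef_add, add_undef]
  by_cases h : Orth a b
  · rw [of_add_of h, of_add_of (orth_symm h), oplus_comm h]
  · rw [of_add_of_eq_undef h, of_add_of_eq_undef fun h' => h (orth_symm h')]

theorem add_assoc_of_eq {a b c s : E} (h : of a + of b + of c = of s) :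
    of a + (of b + of c) = of s := by
  by_cases hab : Orth a b
  · rw [of_add_of hab, of_add_of_eq] at h
    obtain ⟨h1, h2, h3⟩ := orth_assoc a b c hab h.1
    rw [of_add_of h1, of_add_of h2, ← h3, h.2]
  · rw [of_add_of_eq_undef hab, undef_add] at h
    exact absurd h (by simp)

protected theorem add_assoc (x y z : Partial E) : x + y + z = x + (y + z) := by
  obtain a | _ := x
  swap
  · simp only [undef_add]
  obtain b | _ := y
  swap
  · simp only [undef_add, add_undef]
  obtain c | _ := z
  swap
  · simp only [add_undef]
  rcases h : of a + of b + of c with s | _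
  · rw [add_assoc_of_eq h]
  · rcases h' : of a + (of b + of c) with s | _
    -- If the right bracketing is defined, commutativity turns it into a left bracketing and the
    -- one-sided law applies.
    · rw [Partial.add_comm, Partial.add_comm (of b)] at h'
      have := add_assoc_of_eq h'
      rw [Partial.add_comm, Partial.add_comm (of b)] at this
      rw [← h, this]
    · rfl

protected theorem zero_add (x : Partial E) : 0 + x = x := by
  obtain a | _ := x
  swap
  · exact add_undef 0
  · rw [Partial.add_comm, ← of_zero, of_add_of_eq]
    exact orth_zero_oplus a

noncomputable instance : AddCommMonoid (Partial E) where
  add_assoc := Partial.add_assoc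
  zero_add := Partial.zero_add
  add_zero x := (Partial.add_comm x 0).trans (Partial.zero_add x)
  add_comm := Partial.add_comm
  nsmul := nsmulRec

theorem exists_of_add {x y : Partial E} {s : E} (h : x + y = of s) :
    ∃ a b, x = of a ∧ y = of b := by
  obtain a | _ := x
  swap
  · rw [undef_add] at h
    exact absurd h (by simp)
  obtain b | _ := y
  swap
  · rw [add_undef] at h
    exact absurd h (by simp)
  exact ⟨a, b, rfl, rfl⟩

theorem of_add_compl (a : E) : of a + of aᶜ = of 1 := of_add_of_eq.2 (orth_compl a)

theorem eq_compl {a b : E} (h : of a + of b = of 1) : b = aᶜ :=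
  compl_unique a b (of_add_of_eq.1 h).1 (of_add_of_eq.1 h).2

/-- Both `b` and `c` are the orthosupplement of `a ⊕ sᶜ`. -/
theorem add_left_cancel {a b c s : E} (h : of a + of b = of s) (h' : of a + of c = of s) :
    b = c := by
  have h1 : of a + of sᶜ + of b = of 1 := by
    rw [← of_add_compl s, ← h]; exact add_right_comm _ _ _
  have h2 : of a + of sᶜ + of c = of 1 := by
    rw [← of_add_compl s, ← h']; exact add_right_comm _ _ _
  obtain ⟨d, -, hd, -⟩ := exists_of_add h1
  rw [hd] at h1 h2
  rw [eq_compl h1, eq_compl h2]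

theorem eq_zero_of_add {a b : E} (h : of a + of b = of 0) : a = 0 := by
  have h1 : of b + (of a + of 1) = of 1 := by
    rw [← add_assoc, add_comm (of b), h, of_zero, zero_add]
  obtain ⟨-, d, -, hd⟩ := exists_of_add h1
  exact eq_zero_of_orth_one a (of_add_of_eq.1 hd).1

end Partial

theorem le_iff {a b : E} : a ≤ b ↔ ∃ c, of a + of c = of b := by
  simp only [of_add_of_eq]; rfl

theorem le_of_add {a b c : E} (h : of a + of b = of c) : a ≤ c := le_iff.2 ⟨b, h⟩

theorem le_refl' (a : E) : a ≤ a := le_iff.2 ⟨0, by rw [of_zero, add_zero]⟩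

theorem le_trans' {a b c : E} (h : a ≤ b) (h' : b ≤ c) : a ≤ c := by
  obtain ⟨x, hx⟩ := le_iff.1 h
  obtain ⟨y, hy⟩ := le_iff.1 h'
  rw [← hx, add_assoc] at hy
  obtain ⟨-, z, -, hz⟩ := exists_of_add hy
  exact le_iff.2 ⟨z, by rw [← hz, hy]⟩

theorem le_antisymm' {a b : E} (h : a ≤ b) (h' : b ≤ a) : a = b := by
  obtain ⟨x, hx⟩ := le_iff.1 h
  obtain ⟨y, hy⟩ := le_iff.1 h'
  rw [← hx, add_assoc] at hy
  obtain ⟨-, z, -, hz⟩ := exists_of_add hy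
  rw [hz] at hy
  have hz0 : z = 0 := add_left_cancel hy (by rw [of_zero, add_zero])
  rw [hz0] at hz
  have hx0 : x = 0 := eq_zero_of_add hz
  rw [hx0, of_zero, add_zero] at hx
  exact of_inj.1 hx

theorem le_one' (a : E) : a ≤ 1 := le_of_add (of_add_compl a)

theorem zero_le' (a : E) : 0 ≤ a := le_of_add (b := a) (by rw [of_zero, zero_add])

theorem eq_zero_of_le_zero {a : E} (h : a ≤ 0) : a = 0 := le_antisymm' h (zero_le' a)

theorem le_compl_of_add {a b s : E} (h : of a + of b = of s) : a ≤ bᶜ := by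
  refine le_of_add (b := sᶜ) ?_
  have h1 : of b + (of a + of sᶜ) = of 1 := by
    rw [← add_assoc, add_comm (of b), h, of_add_compl]
  obtain ⟨-, d, -, hd⟩ := exists_of_add h1
  rw [hd] at h1 ⊢
  rw [eq_compl h1]

theorem exists_add_of_le_compl {a b : E} (h : a ≤ bᶜ) : ∃ s, of a + of b = of s := by
  obtain ⟨c, hc⟩ := le_iff.1 h
  have h1 := of_add_compl b
  rw [← hc, ← add_assoc, add_comm (of b)] at h1
  obtain ⟨d, -, hd, -⟩ := exists_of_add h1
  exact ⟨d, hd⟩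

theorem compl_le_compl' {a b : E} (h : a ≤ b) : bᶜ ≤ aᶜ := by
  obtain ⟨s, hs⟩ := exists_add_of_le_compl (a := a) (b := bᶜ) (by simpa using h)
  rw [add_comm] at hs
  exact le_compl_of_add hs

theorem le_compl_comm {a b : E} (h : a ≤ bᶜ) : b ≤ aᶜ := by
  simpa using compl_le_compl' h

theorem IsSharp.compl {a : E} (h : IsSharp a) : IsSharp aᶜ :=
  fun x hx hx' => h x (by simpa using hx') hx

/-- A finite family of sharp elements with sum `1`. -/
structure IsSharpPartition {ι : Type*} [Fintype ι] (p : ι → E) : Prop where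
  sharp : ∀ i, IsSharp (p i)
  sum_eq_one : ∑ i, of (p i) = of 1

theorem IsAdditive.map_add {J : E → E} (hJ : IsAdditive J) {a b c : E}
    (h : of a + of b = of c) : of (J a) + of (J b) = of (J c) := by
  obtain ⟨h1, rfl⟩ := of_add_of_eq.1 h
  exact of_add_of_eq.2 ⟨(hJ a b h1).1, (hJ a b h1).2.symm⟩

theorem IsAdditive.map_zero {J : E → E} (hJ : IsAdditive J) : J 0 = 0 :=
  add_left_cancel (hJ.map_add (a := 0) (b := 0) (c := 0) (by rw [of_zero, add_zero]))
    (by rw [of_zero, add_zero])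

theorem IsAdditive.mono {J : E → E} (hJ : IsAdditive J) {a b : E} (h : a ≤ b) : J a ≤ J b := by
  obtain ⟨c, hc⟩ := le_iff.1 h
  exact le_of_add (hJ.map_add hc)

theorem IsAdditive.map_sum {J : E → E} (hJ : IsAdditive J) {ι : Type*} {S : Finset ι}
    {x : ι → E} {a : E} (h : ∑ i ∈ S, of (x i) = of a) : ∑ i ∈ S, of (J (x i)) = of (J a) := by
  classical
  induction S using Finset.induction_on generalizing a with
  | empty =>
    rw [Finset.sum_empty, ← of_zero, of_inj] at h
    rw [Finset.sum_empty, ← h, hJ.map_zero, of_zero]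
  | insert i S hi ih =>
    rw [Finset.sum_insert hi] at h ⊢
    obtain ⟨-, b, -, hb⟩ := exists_of_add h
    rw [hb] at h
    rw [ih hb, hJ.map_add h]

theorem le_of_sum {ι : Type*} {S : Finset ι} {x : ι → E} {a : E}
    (h : ∑ i ∈ S, of (x i) = of a) {i : ι} (hi : i ∈ S) : x i ≤ a := by
  classical
  rw [← Finset.add_sum_erase S _ hi] at h
  obtain ⟨-, b, -, hb⟩ := exists_of_add h
  rw [hb] at h
  exact le_of_add h

theorem IsOrthosum.sum_eq {l : List E} {s : E} (h : IsOrthosum l s) :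
    (l.map of).sum = of s := by
  induction h with
  | nil => rfl
  | cons a s l _ h2 ih => rw [List.map_cons, List.sum_cons, ih, of_add_of h2]

theorem IsOrthosum.sum_fin_eq {n : ℕ} {x : Fin n → E} {s : E}
    (h : IsOrthosum (List.ofFn x) s) : ∑ i, of (x i) = of s := by
  rw [← h.sum_eq, List.map_ofFn, List.sum_ofFn]
  rfl

end Arithmetic

/-! ### Sharp elements, compressions and commutants in a sequential effect algebra -/

section Sequential

local infixl:70 " ⊙ " => SequentialEffectAlgebra.seq

open SequentialEffectAlgebra

variable {E : Type*} [EffectAlgebra E] [SequentialEffectAlgebra E]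

/-- `a` and `b` commute with respect to the sequential product. -/
def SeqCommute (a b : E) : Prop := a ⊙ b = b ⊙ a

theorem SeqCommute.symm {a b : E} (h : SeqCommute a b) : SeqCommute b a := Eq.symm h

theorem isAdditive_seq (a : E) : IsAdditive (fun b => a ⊙ b) := fun b c h => seq_oplus a b c h

theorem seq_add (a : E) {b c d : E} (h : of b + of c = of d) :
    of (a ⊙ b) + of (a ⊙ c) = of (a ⊙ d) := (isAdditive_seq a).map_add h

@[simp]
theorem seq_zero (a : E) : a ⊙ 0 = 0 := (isAdditive_seq a).map_zero

@[simp]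
theorem zero_seq (a : E) : 0 ⊙ a = 0 := seq_zero_symm _ _ (seq_zero a)

theorem SeqCommute.compl_right {a b : E} (h : SeqCommute a b) : SeqCommute a bᶜ :=
  comm_compl a b h

theorem seqCommute_zero (a : E) : SeqCommute a 0 := by simp [SeqCommute]

theorem seqCommute_one (a : E) : SeqCommute a 1 := by
  simpa using (seqCommute_zero a).compl_right

@[simp]
theorem seq_one (a : E) : a ⊙ 1 = a := (seqCommute_one a).trans (one_seq a)

theorem seq_mono (a : E) {b c : E} (h : b ≤ c) : a ⊙ b ≤ a ⊙ c := (isAdditive_seq a).mono h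

theorem seq_le (a b : E) : a ⊙ b ≤ a := by
  simpa using seq_mono a (le_one' b)

theorem seq_add_compl (a b : E) : of (a ⊙ b) + of (a ⊙ bᶜ) = of a := by
  simpa using seq_add a (of_add_compl b)

theorem seqCommute_of_seq_eq_zero {a b : E} (h : a ⊙ b = 0) : SeqCommute a b :=
  h.trans (seq_zero_symm _ _ h).symm

theorem SeqCommute.add {a b c d : E} (ha : SeqCommute d a) (hb : SeqCommute d b)
    (h : of a + of b = of c) : SeqCommute d c := by
  obtain ⟨h1, rfl⟩ := of_add_of_eq.1 h
  exact comm_oplus a b d ha hb h1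

/-- Differences reduce to sums and complements: `b = (a ⊕ cᶜ)ᶜ`. -/
theorem SeqCommute.sub {a b c d : E} (ha : SeqCommute d a) (hc : SeqCommute d c)
    (h : of a + of b = of c) : SeqCommute d b := by
  have h1 : of a + of cᶜ + of b = of 1 := by
    rw [← of_add_compl c, ← h, add_right_comm]
  obtain ⟨s, -, hs, -⟩ := exists_of_add h1
  rw [hs] at h1
  rw [eq_compl h1]
  exact (ha.add hc.compl_right hs).compl_right

theorem SeqCommute.seq {a b c : E} (ha : SeqCommute c a) (hb : SeqCommute c b) :
    SeqCommute c (a ⊙ b) := comm_seq a b c ha hb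

theorem SeqCommute.sum {ι : Type*} {S : Finset ι} {x : ι → E} {a c : E}
    (hx : ∀ i ∈ S, SeqCommute c (x i)) (h : ∑ i ∈ S, of (x i) = of a) : SeqCommute c a := by
  classical
  induction S using Finset.induction_on generalizing a with
  | empty =>
    rw [Finset.sum_empty, ← of_zero, of_inj] at h
    rw [← h]
    exact seqCommute_zero c
  | insert i S hi ih =>
    rw [Finset.sum_insert hi] at h
    obtain ⟨-, b, -, hb⟩ := exists_of_add h
    rw [hb] at h
    exact (hx i (Finset.mem_insert_self i S)).add
      (ih (fun j hj => hx j (Finset.mem_insert_of_mem hj)) hb) h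

/-- Since `a` commutes with `aᶜ`, their product lies below both. Conversely, if the product is `0`
and `x` lies below both, then `x ∘ a` and `x ∘ aᶜ` vanish, and they sum to `x`. -/
theorem isSharp_iff_seq_compl {a : E} : IsSharp a ↔ a ⊙ aᶜ = 0 := by
  constructor
  · intro h
    refine h _ (seq_le _ _) ?_
    rw [SequentialEffectAlgebra.comm_compl a a rfl]
    exact seq_le _ _
  · intro h x hx hx'
    have h1 : x ⊙ a = 0 := seq_zero_symm _ _ (eq_zero_of_le_zero (h ▸ seq_mono a hx'))
    have h2 : x ⊙ aᶜ = 0 := seq_zero_symm _ _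
      (eq_zero_of_le_zero (seq_zero_symm _ _ h ▸ seq_mono aᶜ hx))
    have h3 := seq_add_compl x a
    rw [h1, h2, of_zero, zero_add, ← of_zero, of_inj] at h3
    exact h3.symm

theorem isSharp_iff_seq_self {a : E} : IsSharp a ↔ a ⊙ a = a := by
  rw [isSharp_iff_seq_compl]
  have h := seq_add_compl a a
  constructor
  · intro h'
    rwa [h', of_zero, add_zero, of_inj] at h
  · intro h'
    rw [h'] at h
    exact add_left_cancel h (by rw [of_zero, add_zero])

theorem isSharp_zero : IsSharp (0 : E) := isSharp_iff_seq_self.2 (by simp)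

theorem isSharp_one : IsSharp (1 : E) := isSharp_iff_seq_self.2 (by simp)

theorem IsSharp.compl_seq_of_le {p a : E} (hp : IsSharp p) (h : a ≤ p) : pᶜ ⊙ a = 0 :=
  eq_zero_of_le_zero (seq_zero_symm _ _ (isSharp_iff_seq_compl.1 hp) ▸ seq_mono pᶜ h)

theorem SeqCommute.of_compl {a b : E} (h : SeqCommute a bᶜ) : SeqCommute a b := by
  simpa using h.compl_right

theorem IsSharp.seqCommute_of_le {p a : E} (hp : IsSharp p) (h : a ≤ p) : SeqCommute p a :=
  (SeqCommute.of_compl (seqCommute_of_seq_eq_zero (hp.compl_seq_of_le h)).symm).symm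

theorem IsSharp.seq_eq_of_le {p a : E} (hp : IsSharp p) (h : a ≤ p) : p ⊙ a = a := by
  have h1 := seq_add_compl a p
  rw [seq_zero_symm _ _ (hp.compl_seq_of_le h), of_zero, add_zero, of_inj] at h1
  exact (hp.seqCommute_of_le h).trans h1

theorem IsSharp.seq_eq_zero_of_le_compl {p a : E} (hp : IsSharp p) (h : a ≤ pᶜ) : p ⊙ a = 0 := by
  simpa using hp.compl.compl_seq_of_le h

/-- A zero product forces commutation, so `a = a ∘ pᶜ = pᶜ ∘ a`. -/
theorem le_compl_of_seq_eq_zero {p a : E} (h : p ⊙ a = 0) : a ≤ pᶜ := by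
  have h1 := seq_add_compl a p
  rw [seq_zero_symm _ _ h, of_zero, zero_add, of_inj,
    ((seqCommute_of_seq_eq_zero h).symm.compl_right : a ⊙ pᶜ = _)] at h1
  exact h1 ▸ seq_le _ _

theorem IsSharp.seq_eq_zero_iff {p a : E} (hp : IsSharp p) : p ⊙ a = 0 ↔ a ≤ pᶜ :=
  ⟨le_compl_of_seq_eq_zero, hp.seq_eq_zero_of_le_compl⟩

theorem IsSharp.le_iff_compl_seq {p a : E} (hp : IsSharp p) : a ≤ p ↔ pᶜ ⊙ a = 0 := by
  rw [hp.compl.seq_eq_zero_iff, compl_compl]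

theorem IsSharp.seqCommute_of_le_compl {p a : E} (hp : IsSharp p) (h : a ≤ pᶜ) :
    SeqCommute p a := seqCommute_of_seq_eq_zero (hp.seq_eq_zero_of_le_compl h)

theorem IsSharp.add {p q s : E} (hp : IsSharp p) (hq : IsSharp q) (h : of p + of q = of s) :
    IsSharp s := by
  have h' := h
  rw [add_comm] at h'
  have hpq : p ⊙ q = 0 := hp.seq_eq_zero_of_le_compl (le_compl_of_add h')
  have hc : SeqCommute p q := seqCommute_of_seq_eq_zero hpq
  have hps : SeqCommute p s := SeqCommute.add rfl hc h
  have hqs : SeqCommute q s := SeqCommute.add hc.symm rfl h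
  have h1 := seq_add p h
  rw [isSharp_iff_seq_self.1 hp, hpq, of_zero, add_zero, of_inj] at h1
  have h2 := seq_add q h
  rw [isSharp_iff_seq_self.1 hq, seq_zero_symm _ _ hpq, of_zero, zero_add, of_inj] at h2
  have h3 := seq_add s h
  rw [← (hps : p ⊙ s = _), ← (hqs : q ⊙ s = _), ← h1, ← h2, h, of_inj] at h3
  exact isSharp_iff_seq_self.2 h3.symm

/-- Sharpness turns `a ≤ u` into the additive condition `uᶜ ∘ a = 0`. -/
theorem IsSharp.add_le {s a b u : E} (hu : IsSharp u) (ha : a ≤ u) (hb : b ≤ u)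
    (h : of a + of b = of s) : s ≤ u := by
  rw [hu.le_iff_compl_seq] at *
  have h1 := seq_add uᶜ h
  rw [ha, hb, of_zero, zero_add, ← of_zero, of_inj] at h1
  exact h1.symm

theorem IsSharp.sum {ι : Type*} {S : Finset ι} {x : ι → E} {a : E}
    (hx : ∀ i ∈ S, IsSharp (x i)) (h : ∑ i ∈ S, of (x i) = of a) : IsSharp a := by
  classical
  induction S using Finset.induction_on generalizing a with
  | empty =>
    rw [Finset.sum_empty, ← of_zero, of_inj] at h
    rw [← h]
    exact isSharp_zero
  | insert i S hi ih =>
    rw [Finset.sum_insert hi] at h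
    obtain ⟨-, b, -, hb⟩ := exists_of_add h
    rw [hb] at h
    exact (hx i (Finset.mem_insert_self i S)).add
      (ih (fun j hj => hx j (Finset.mem_insert_of_mem hj)) hb) h

theorem IsSharp.seq {p q : E} (hp : IsSharp p) (hq : IsSharp q) (h : SeqCommute p q) :
    IsSharp (p ⊙ q) := by
  have h1 : SeqCommute (p ⊙ q) p := (SeqCommute.seq rfl h).symm
  have h2 : p ⊙ q ≤ q := by rw [(h : p ⊙ q = _)]; exact seq_le _ _
  rw [isSharp_iff_seq_self, seq_assoc _ _ h1, ← (h1.symm : p ⊙ (p ⊙ q) = _),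
    hp.seq_eq_of_le (seq_le p q), ← (hq.seqCommute_of_le h2 : q ⊙ _ = _), hq.seq_eq_of_le h2]

/-- The product of two sharp elements with a common part `d` and orthogonal remainders. -/
theorem IsSharp.seq_eq_of_common {p q e f d s : E} (hp : IsSharp p)
    (hep : of e + of d = of p) (hfq : of f + of d = of q) (hs : of e + of f + of d = of s) :
    p ⊙ q = d := by
  have h1 : p ⊙ f = 0 := by
    refine hp.seq_eq_zero_of_le_compl (le_compl_of_add (s := s) ?_)
    rw [← hep, ← hs]; abel
  have h2 : p ⊙ d = d := hp.seq_eq_of_le (le_of_add (by rw [add_comm]; exact hep))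
  have h3 := seq_add p hfq
  rw [h1, h2, of_zero, zero_add, of_inj] at h3
  exact h3.symm

theorem IsSharp.seqCommute_of_compatible {p q : E} (hp : IsSharp p) (hq : IsSharp q)
    (h : Compatible p q) : SeqCommute p q := by
  obtain ⟨e, f, d, h1, h2, ⟨h3, h3'⟩, h4, h4'⟩ := h
  have hs : of e + of f + of d = of (oplus (oplus e f) d) := by
    rw [of_add_of h1, of_add_of h2]
  have hep : of e + of d = of p := by rw [of_add_of h3, h3']
  have hfq : of f + of d = of q := by rw [of_add_of h4, h4']
  rw [SeqCommute, hp.seq_eq_of_common hep hfq hs, hq.seq_eq_of_common hfq hep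
    (by rw [add_comm (of f)]; exact hs)]

/-- The summands `p ∘ a ≤ p` and `pᶜ ∘ a ≤ pᶜ` always commute with `p`; conversely, commutation
turns `a = a ∘ p ⊕ a ∘ pᶜ` into the required splitting. -/
theorem IsSharp.mem_commutant_iff {p a : E} (hp : IsSharp p) :
    a ∈ commutant (fun p a : E => p ⊙ a) p ↔ SeqCommute p a := by
  have key : a ∈ commutant (fun p a : E => p ⊙ a) p ↔ of (p ⊙ a) + of (pᶜ ⊙ a) = of a := by
    rw [of_add_of_eq, @eq_comm _ _ a]; rfl
  rw [key]
  constructor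
  · intro h
    exact (hp.seqCommute_of_le (seq_le p a)).add (hp.seqCommute_of_le_compl (seq_le pᶜ a)) h
  · intro h
    have h1 := seq_add_compl a p
    rwa [← (h : p ⊙ a = _), (h.symm.compl_right : a ⊙ pᶜ = _)] at h1

theorem mem_projCommutant_iff {A : Set E} {p : E} :
    p ∈ projCommutant {p : E | IsSharp p} (fun p a : E => p ⊙ a) A ↔
      IsSharp p ∧ ∀ a ∈ A, SeqCommute p a := by
  constructor
  · rintro ⟨hp, h⟩
    exact ⟨hp, fun a ha => (IsSharp.mem_commutant_iff hp).1 (h a ha)⟩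
  · rintro ⟨hp, h⟩
    exact ⟨hp, fun a ha => hp.mem_commutant_iff.2 (h a ha)⟩

theorem mem_bicommutant_iff {A : Set E} {p : E} :
    p ∈ bicommutant {p : E | IsSharp p} (fun p a : E => p ⊙ a) A ↔
      IsSharp p ∧ (∀ a ∈ A, SeqCommute p a) ∧
        ∀ q, IsSharp q → (∀ a ∈ A, SeqCommute q a) → SeqCommute p q := by
  rw [bicommutant, mem_projCommutant_iff]
  constructor
  · rintro ⟨hp, h⟩
    exact ⟨hp, fun a ha => h a (Or.inr ha),
      fun q hq hqA => h q (Or.inl (mem_projCommutant_iff.2 ⟨hq, hqA⟩))⟩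
  · rintro ⟨hp, h, h'⟩
    refine ⟨hp, ?_⟩
    rintro a (ha | ha)
    · exact h' a (mem_projCommutant_iff.1 ha).1 (mem_projCommutant_iff.1 ha).2
    · exact h a ha

theorem isSubEffectAlgebra_isSharp : IsSubEffectAlgebra {p : E | IsSharp p} where
  zero_mem := isSharp_zero
  one_mem := isSharp_one
  compl_mem _ ha := IsSharp.compl ha
  oplus_mem _ ha _ hb h := IsSharp.add ha hb (of_add_of h)

theorem isCompressionBase_isSharp :
    IsCompressionBase {p : E | IsSharp p} (fun p a : E => p ⊙ a) where
  sub := isSubEffectAlgebra_isSharp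
  compression p hp :=
    { additive := isAdditive_seq p
      fixes := fun a ha => IsSharp.seq_eq_of_le hp (by simpa using ha)
      eq_zero_iff := fun a => by simpa using IsSharp.seq_eq_zero_iff hp }
  focus p _ := seq_one p
  normal e f d h1 h2 he hf := by
    have h3 := orth_assoc e f d h1 h2
    have hs : of e + of f + of d = of (oplus (oplus e f) d) := by
      rw [of_add_of h1, of_add_of h2]
    have hs' := hs
    rw [add_right_comm] at hs'
    obtain ⟨x, -, hx, -⟩ := exists_of_add hs'
    have hep := of_add_of (of_add_of_eq.1 hx).1
    have hfq := of_add_of h3.1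
    have hd := IsSharp.seq_eq_of_common he hep hfq hs
    have hd' := IsSharp.seq_eq_of_common hf hfq hep (by rw [add_comm (of f)]; exact hs)
    rw [← hd]
    exact IsSharp.seq he hf (hd.trans hd'.symm)
  comp p hp q hq r hr h1 h2 a := by
    have h3 := orth_assoc p q r h1 h2
    have hs : of p + of q + of r = of (oplus (oplus p q) r) := by
      rw [of_add_of h1, of_add_of h2]
    have hpq := of_add_of h1
    have hqr : of r + of q = of (oplus q r) := by rw [add_comm, of_add_of h3.1]
    have hd := (IsSharp.add hp hq hpq).seq_eq_of_common hpq hqr (s := oplus (oplus p q) r)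
      (by rw [← hs]; abel)
    have hd' := (IsSharp.add hr hq hqr).seq_eq_of_common hqr hpq (s := oplus (oplus p q) r)
      (by rw [← hs]; abel)
    change oplus p q ⊙ (oplus q r ⊙ a) = q ⊙ a
    -- `p ⊕ q` and `q ⊕ r` commute with product `q`, so associativity applies.
    rw [seq_assoc _ _ (hd.trans hd'.symm), hd]

theorem IsSharp.le_seq {x p q : E} (hp : IsSharp p)
    (hxp : x ≤ p) (hxq : x ≤ q) : x ≤ p ⊙ q := by
  rw [← hp.seq_eq_of_le hxp]
  exact seq_mono p hxq

/-- A set of mutually commuting sharp elements which is closed under complements, orthogonal sums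
and products is a Boolean subalgebra. -/
theorem isBooleanSubalgebra_of_commute {B : Set E} (hB : B ⊆ {p : E | IsSharp p})
    (hsub : IsSubEffectAlgebra B) (hcomm : ∀ x ∈ B, ∀ y ∈ B, SeqCommute x y)
    (hseq : ∀ x ∈ B, ∀ y ∈ B, x ⊙ y ∈ B) : IsBooleanSubalgebra {p : E | IsSharp p} B := by
  refine ⟨hB, hsub, ?_⟩
  have seq_le_right : ∀ x ∈ B, ∀ y ∈ B, x ⊙ y ≤ y := fun x hx y hy => by
    rw [(hcomm x hx y hy : x ⊙ y = _)]; exact seq_le _ _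
  -- Meets are products; joins come from De Morgan.
  let L : Lattice B :=
    { le := fun x y => (x : E) ≤ (y : E)
      le_refl := fun x => le_refl' _
      le_trans := fun x y z => le_trans'
      le_antisymm := fun x y h h' => Subtype.ext (le_antisymm' h h')
      inf := fun x y => ⟨x ⊙ y, hseq _ x.2 _ y.2⟩
      inf_le_left := fun x y => seq_le _ _
      inf_le_right := fun x y => seq_le_right _ x.2 _ y.2
      le_inf := fun x y z h h' =>
        IsSharp.le_seq (hB y.2) h h'
      sup := fun x y => ⟨((x : E)ᶜ ⊙ (y : E)ᶜ)ᶜ,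
        hsub.compl_mem _ (hseq _ (hsub.compl_mem _ x.2) _ (hsub.compl_mem _ y.2))⟩
      le_sup_left := fun x y => le_compl_comm (seq_le _ _)
      le_sup_right := fun x y =>
        le_compl_comm (seq_le_right _ (hsub.compl_mem _ x.2) _ (hsub.compl_mem _ y.2))
      sup_le := fun x y z h h' => by
        have hx := hsub.compl_mem _ x.2
        have hy := hsub.compl_mem _ y.2
        have := compl_le_compl' (IsSharp.le_seq (hB hx)
          (compl_le_compl' h) (compl_le_compl' h'))
        rwa [compl_compl] at this }
  -- Multiplying an orthogonal decomposition of `y ⊔ z` by `x` gives two terms, each below the sharp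
  -- right-hand side; `IsSharp.add_le` then bounds their sum.
  let D : DistribLattice B := DistribLattice.ofInfSupLe (α := B) fun x y z => by
    change (x : E) ⊙ ((y : E)ᶜ ⊙ (z : E)ᶜ)ᶜ ≤ (((x : E) ⊙ y)ᶜ ⊙ ((x : E) ⊙ z)ᶜ)ᶜ
    have hy := hsub.compl_mem _ y.2
    have hz := hsub.compl_mem _ z.2
    have hxy := hseq _ x.2 _ y.2
    have hxz := hseq _ x.2 _ z.2
    have hu := hsub.compl_mem _ (hseq _ (hsub.compl_mem _ hxy) _ (hsub.compl_mem _ hxz))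
    -- `y ⊔ z` is the orthogonal sum of `y` and `yᶜ ⊙ z`
    have h1 : of (y : E) + of ((y : E)ᶜ ⊙ z) = of ((y : E)ᶜ ⊙ (z : E)ᶜ)ᶜ := by
      have h2 : of ((y : E)ᶜ ⊙ (z : E)ᶜ) + (of (y : E) + of ((y : E)ᶜ ⊙ z)) = of 1 := by
        rw [← of_add_compl (y : E), ← seq_add_compl (y : E)ᶜ z]; abel
      obtain ⟨-, s, -, h3⟩ := exists_of_add h2
      rw [h3] at h2 ⊢
      rw [eq_compl h2]
    refine (hB hu).add_le ?_ ?_ (seq_add (x : E) h1)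
    · exact le_compl_comm (seq_le _ _)
    · rw [seq_assoc _ _ (hcomm _ x.2 _ hy), (hcomm _ x.2 _ hy : (x : E) ⊙ (y : E)ᶜ = _),
        ← seq_assoc _ _ (hcomm _ hy _ x.2)]
      exact le_trans' (seq_le_right _ hy _ hxz)
        (le_compl_comm (seq_le_right _ (hsub.compl_mem _ hxy) _ (hsub.compl_mem _ hxz)))
  refine ⟨{ D with
    compl := fun x => ⟨(x : E)ᶜ, hsub.compl_mem _ x.2⟩
    top := ⟨1, hsub.one_mem⟩
    bot := ⟨0, hsub.zero_mem⟩
    le_top := fun x => le_one' (x : E)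
    bot_le := fun x => zero_le' (x : E)
    inf_compl_le_bot := fun x => ?_
    top_le_sup_compl := fun x => ?_ }, fun x y => Iff.rfl, fun x => rfl⟩
  · change (x : E) ⊙ (x : E)ᶜ ≤ 0
    rw [isSharp_iff_seq_compl.1 (hB x.2)]
    exact le_refl' 0
  · change (1 : E) ≤ ((x : E)ᶜ ⊙ (x : E)ᶜᶜ)ᶜ
    rw [isSharp_iff_seq_compl.1 (hB (hsub.compl_mem _ x.2)), compl_zero]
    exact le_refl' 1

theorem isBooleanSubalgebra_bicommutant (a : E) :
    IsBooleanSubalgebra {p : E | IsSharp p}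
      (bicommutant {p : E | IsSharp p} (fun p a : E => p ⊙ a) {a}) := by
  have hcomm : ∀ x ∈ bicommutant {p : E | IsSharp p} (fun p a : E => p ⊙ a) {a},
      ∀ y ∈ bicommutant {p : E | IsSharp p} (fun p a : E => p ⊙ a) {a}, SeqCommute x y := by
    intro x hx y hy
    rw [mem_bicommutant_iff] at hx hy
    -- `y` commutes with `a`, hence lies in the commutant that `x` commutes with.
    exact hx.2.2 y hy.1 hy.2.1
  refine isBooleanSubalgebra_of_commute (fun x hx => hx.1) ⟨?_, ?_, ?_, ?_⟩ hcomm ?_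
  · exact mem_bicommutant_iff.2 ⟨isSharp_zero, fun a _ => (seqCommute_zero a).symm,
      fun q _ _ => (seqCommute_zero q).symm⟩
  · exact mem_bicommutant_iff.2 ⟨isSharp_one, fun a _ => (seqCommute_one a).symm,
      fun q _ _ => (seqCommute_one q).symm⟩
  · intro x hx
    rw [mem_bicommutant_iff] at hx ⊢
    exact ⟨hx.1.compl, fun a ha => (hx.2.1 a ha).symm.compl_right.symm,
      fun q hq hqa => (hx.2.2 q hq hqa).symm.compl_right.symm⟩
  · intro x hx y hy h
    rw [mem_bicommutant_iff] at hx hy ⊢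
    exact ⟨hx.1.add hy.1 (of_add_of h),
      fun a ha => ((hx.2.1 a ha).symm.add (hy.2.1 a ha).symm (of_add_of h)).symm,
      fun q hq hqa => ((hx.2.2 q hq hqa).symm.add (hy.2.2 q hq hqa).symm (of_add_of h)).symm⟩
  · intro x hx y hy
    have hxy := hcomm x hx y hy
    rw [mem_bicommutant_iff] at hx hy ⊢
    exact ⟨hx.1.seq hy.1 hxy,
      fun a ha => ((hx.2.1 a ha).symm.seq (hy.2.1 a ha).symm).symm,
      fun q hq hqa => ((hx.2.2 q hq hqa).symm.seq (hy.2.2 q hq hqa).symm).symm⟩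

/-- A sharp element commuting with `a` commutes with the projection cover of `a`, provided that
all elements have projection covers. -/
theorem IsSharp.seqCommute_cover (hcov : HasProjectionCoverProperty {p : E | IsSharp p})
    {q a c : E} (hq : IsSharp q) (h : SeqCommute q a)
    (hc : IsProjectionCover {p : E | IsSharp p} a c) : SeqCommute q c := by
  -- The covers `x ≤ q` and `y ≤ qᶜ` of the two halves of `a` are orthogonal; their sum turns out to
  -- be `c`.
  obtain ⟨x, hx, hx'⟩ := hcov (q ⊙ a)
  obtain ⟨y, hy, hy'⟩ := hcov (qᶜ ⊙ a)
  have hxq : x ≤ q := (hx' q hq).1 (seq_le _ _)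
  have hyq : y ≤ qᶜ := (hy' qᶜ hq.compl).1 (seq_le _ _)
  obtain ⟨s, hs⟩ := exists_add_of_le_compl (le_trans' hxq (le_compl_comm hyq))
  have ha : of (q ⊙ a) + of (qᶜ ⊙ a) = of a := by
    have h1 := seq_add_compl a q
    rwa [← (h : q ⊙ a = _), (h.symm.compl_right : a ⊙ qᶜ = _)] at h1
  have hss : IsSharp s := IsSharp.add hx hy hs
  have hs' := hs
  rw [add_comm] at hs'
  have h1 : c ≤ s := (hc.2 s hss).1 (hss.add_le
    (le_trans' ((hx' x hx).2 (le_refl' x)) (le_of_add hs))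
    (le_trans' ((hy' y hy).2 (le_refl' y)) (le_of_add hs')) ha)
  have hac : a ≤ c := (hc.2 c hc.1).2 (le_refl' c)
  have ha' := ha
  rw [add_comm] at ha'
  have h2 : s ≤ c := IsSharp.add_le hc.1 ((hx' c hc.1).1 (le_trans' (le_of_add ha) hac))
    ((hy' c hc.1).1 (le_trans' (le_of_add ha') hac)) hs
  rw [le_antisymm' h1 h2]
  exact (hq.seqCommute_of_le hxq).add (hq.seqCommute_of_le_compl hyq) hs

theorem IsSharpPartition.seqCommute {ι : Type*} [Fintype ι] {p : ι → E}
    (hp : IsSharpPartition p) (i j : ι) : SeqCommute (p i) (p j) := by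
  classical
  by_cases hij : j = i
  · rw [hij]; rfl
  have h := hp.sum_eq_one
  rw [← Finset.add_sum_erase _ _ (Finset.mem_univ i)] at h
  obtain ⟨-, b, -, hb⟩ := exists_of_add h
  have hj : p j ≤ b := le_of_sum hb (Finset.mem_erase.2 ⟨hij, Finset.mem_univ j⟩)
  rw [hb, add_comm] at h
  exact (hp.sharp i).seqCommute_of_le_compl (le_trans' hj (le_compl_of_add h))

end Sequential

/-! ### Weighted sums over sharp partitions and the spectral resolution -/

section Weighted

local infixl:70 " ⊙ " => SequentialEffectAlgebra.seq

open SequentialEffectAlgebra ConvexEffectAlgebra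

variable {E : Type*} [EffectAlgebra E] [ConvexEffectAlgebra E]

theorem scale_add_eq {l m k : unitInterval} (h : (l : ℝ) + m = k) (a : E) :
    of (scale l a) + of (scale m a) = of (scale k a) :=
  of_add_of_eq.2 ⟨(scale_add l m k a h).1, (scale_add l m k a h).2.symm⟩

theorem isAdditive_scale (l : unitInterval) : IsAdditive (scale l : E → E) :=
  fun a b h => scale_oplus l a b h

@[simp]
theorem zero_scale (a : E) : scale 0 a = 0 :=
  add_left_cancel (scale_add_eq (l := 0) (m := 0) (k := 0) (by simp) a)
    (by rw [of_zero, add_zero])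

attribute [simp] ConvexEffectAlgebra.one_scale

theorem scale_mono_left {l m : unitInterval} (h : l ≤ m) (a : E) : scale l a ≤ scale m a :=
  le_of_add (scale_add_eq (l := l)
    (m := ⟨m - l, sub_nonneg.2 h, (sub_le_self _ l.2.1).trans m.2.2⟩) (by simp) a)

theorem scale_le (l : unitInterval) (a : E) : scale l a ≤ a := by
  simpa using scale_mono_left (show l ≤ 1 from l.2.2) a

open Classical in
/-- The `0`-`1`-valued weight function of a predicate. -/
noncomputable def indicatorWeight {ι : Type*} (s : ι → Prop) (i : ι) : unitInterval :=
  if s i then 1 else 0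

/-- The element `a` with `of a = x`, or `0` if there is none. -/
def Partial.value : Partial E → E
  | of a => a
  | undef => 0

/-- The weighted sum `⊕ μᵢ pᵢ`. -/
noncomputable def weightedSum {ι : Type*} [Fintype ι] (p : ι → E) (μ : ι → unitInterval) : E :=
  (∑ i, of (scale (μ i) (p i))).value

section Partition

variable {ι : Type*} [Fintype ι] {p : ι → E}

theorem weightedSum_eq {μ : ι → unitInterval} {a : E}
    (h : ∑ i, of (scale (μ i) (p i)) = of a) : weightedSum p μ = a := by
  rw [weightedSum, h]; rfl

/-- Adding the sum with weights `1 - μᵢ` yields `1`, so the sum is defined and the default of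
`Partial.value` never occurs. -/
theorem IsSharpPartition.of_weightedSum (hp : IsSharpPartition p) (μ : ι → unitInterval) :
    ∑ i, of (scale (μ i) (p i)) = of (weightedSum p μ) := by
  have h : ∑ i, of (scale (μ i) (p i)) + ∑ i, of (scale (unitInterval.symm (μ i)) (p i))
      = of 1 := by
    rw [← hp.sum_eq_one, ← Finset.sum_add_distrib]
    refine Finset.sum_congr rfl fun i _ => ?_
    rw [scale_add_eq (k := 1) (by simp), one_scale]
  obtain ⟨a, -, ha, -⟩ := exists_of_add h
  rw [ha, weightedSum_eq ha]

theorem IsSharpPartition.weightedSum_add (hp : IsSharpPartition p) {μ ν ρ : ι → unitInterval}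
    (h : ∀ i, (μ i : ℝ) + ν i = ρ i) :
    of (weightedSum p μ) + of (weightedSum p ν) = of (weightedSum p ρ) := by
  rw [← hp.of_weightedSum, ← hp.of_weightedSum, ← hp.of_weightedSum, ← Finset.sum_add_distrib]
  exact Finset.sum_congr rfl fun i _ => scale_add_eq (h i) _

theorem IsSharpPartition.weightedSum_mono (hp : IsSharpPartition p) {μ ν : ι → unitInterval}
    (h : ∀ i, μ i ≤ ν i) : weightedSum p μ ≤ weightedSum p ν :=
  le_of_add (hp.weightedSum_add (μ := μ)
    (ν := fun i => ⟨ν i - μ i, sub_nonneg.2 (h i), (sub_le_self _ (μ i).2.1).trans (ν i).2.2⟩)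
    (by simp))

theorem IsSharpPartition.weightedSum_one (hp : IsSharpPartition p) :
    weightedSum p (fun _ => 1) = 1 := weightedSum_eq (by simpa using hp.sum_eq_one)

theorem weightedSum_zero (p : ι → E) : weightedSum p (fun _ => 0) = 0 := weightedSum_eq (by simp [of_zero])

theorem IsSharpPartition.scale_weightedSum (hp : IsSharpPartition p) (c : unitInterval)
    (μ : ι → unitInterval) :
    scale c (weightedSum p μ) = weightedSum p (fun i => μ i * c) := by
  refine (weightedSum_eq ?_).symm
  rw [← (isAdditive_scale c).map_sum (hp.of_weightedSum μ)]
  exact Finset.sum_congr rfl fun i _ => by rw [scale_scale]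

theorem IsSharpPartition.weightedSum_indicator_compl (hp : IsSharpPartition p) (s : ι → Prop) :
    weightedSum p (indicatorWeight fun i => ¬ s i) = (weightedSum p (indicatorWeight s))ᶜ := by
  refine eq_compl ?_
  rw [← hp.weightedSum_one]
  refine hp.weightedSum_add fun i => ?_
  by_cases h : s i <;> simp [indicatorWeight, h]

variable [SequentialEffectAlgebra E]

theorem IsSharpPartition.isSharp_indicator (hp : IsSharpPartition p) (s : ι → Prop) :
    IsSharp (weightedSum p (indicatorWeight s)) := by
  refine IsSharp.sum (fun i _ => ?_) (hp.of_weightedSum _)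
  by_cases h : s i
  · simpa [indicatorWeight, h] using hp.sharp i
  · simpa [indicatorWeight, h] using isSharp_zero

/-- No law links scalars to the product. Instead `p` splits into parts below `q` and `qᶜ`, and
scaling keeps them there. -/
theorem IsSharp.seqCommute_scale {p q : E} (hq : IsSharp q)
    (h : SeqCommute q p) (c : unitInterval) : SeqCommute q (scale c p) := by
  have h1 := seq_add_compl p q
  rw [← (h : q ⊙ p = _), (h.symm.compl_right : p ⊙ qᶜ = _)] at h1
  exact (hq.seqCommute_of_le (le_trans' (scale_le c _) (seq_le q p))).add
    (hq.seqCommute_of_le_compl (le_trans' (scale_le c _) (seq_le qᶜ p)))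
    ((isAdditive_scale c).map_add h1)

theorem IsSharpPartition.seqCommute_weightedSum (hp : IsSharpPartition p) {q : E}
    (hq : IsSharp q) (h : ∀ i, SeqCommute q (p i)) (μ : ι → unitInterval) :
    SeqCommute q (weightedSum p μ) :=
  SeqCommute.sum (fun i _ => hq.seqCommute_scale (h i) (μ i)) (hp.of_weightedSum μ)

/-- The part of `μ` on `s` lies below the sharp factor and is fixed; the rest lies below its
complement and is killed. -/
theorem IsSharpPartition.indicator_seq (hp : IsSharpPartition p) (s : ι → Prop)
    (μ : ι → unitInterval) :
    weightedSum p (indicatorWeight s) ⊙ weightedSum p μ =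
      weightedSum p (fun i => indicatorWeight s i * μ i) := by
  have hs := hp.isSharp_indicator s
  have h := hp.weightedSum_add (μ := fun i => indicatorWeight s i * μ i)
    (ν := fun i => indicatorWeight (fun i => ¬ s i) i * μ i) (ρ := μ) fun i => by
      by_cases h : s i <;> simp [indicatorWeight, h]
  have h1 := seq_add (weightedSum p (indicatorWeight s)) h
  rw [hs.seq_eq_of_le (hp.weightedSum_mono fun i => unitInterval.mul_le_left),
    hs.seq_eq_zero_of_le_compl, of_zero, add_zero, of_inj] at h1
  · exact h1.symm
  · rw [← hp.weightedSum_indicator_compl]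
    exact hp.weightedSum_mono fun i => unitInterval.mul_le_left

/-- Additivity alone permits doubling the scalar; finitely many doublings bring it above `1/2`. -/
theorem seq_eq_zero_of_seq_scale (c x : E) {t : unitInterval} (ht : 0 < t)
    (h : c ⊙ scale t x = 0) : c ⊙ x = 0 := by
  obtain ⟨n, hn⟩ := exists_pow_lt_of_lt_one (show (0 : ℝ) < t from ht) one_half_lt_one
  induction n generalizing t with
  | zero => exact absurd hn (by simpa using t.2.2)
  | succ n ih =>
    have double : ∀ {s k : unitInterval}, (s : ℝ) + s = k → c ⊙ scale s x = 0 →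
        c ⊙ scale k x = 0 := fun {s k} hk hs => by
      have h1 := seq_add c (scale_add_eq hk x)
      rw [hs, of_zero, zero_add, ← of_zero, of_inj] at h1
      exact h1.symm
    by_cases h2 : (t : ℝ) ≤ 1 / 2
    · have ht' : (0 : ℝ) < t := ht
      have hk : (t : ℝ) + t ∈ unitInterval := ⟨by linarith, by linarith⟩
      refine ih (t := ⟨t + t, hk⟩) (show (0 : ℝ) < t + t by linarith) (double rfl h) ?_
      rw [pow_succ] at hn
      change _ < (t : ℝ) + t
      linarith
    -- Here `2t` would exceed `1`, so `t` is first lowered to `1/2`, whose double is exactly `1`.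
    · let s : unitInterval := ⟨1 / 2, by norm_num, by norm_num⟩
      have hs : c ⊙ scale s x = 0 := eq_zero_of_le_zero
        (h ▸ seq_mono c (scale_mono_left (show s ≤ t from (not_le.1 h2).le) x))
      simpa using double (s := s) (k := 1) (by norm_num [s]) hs

theorem IsSharpPartition.seq_support_eq_zero (hp : IsSharpPartition p) (μ : ι → unitInterval)
    {c : E} (h : c ⊙ weightedSum p μ = 0) :
    c ⊙ weightedSum p (indicatorWeight fun i => 0 < μ i) = 0 := by
  have h1 := (isAdditive_seq c).map_sum
    (hp.of_weightedSum (indicatorWeight fun i => 0 < μ i))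
  rw [← of_inj, ← h1, of_zero]
  refine Finset.sum_eq_zero fun i _ => ?_
  by_cases hi : 0 < μ i
  · have h2 := le_of_sum ((isAdditive_seq c).map_sum (hp.of_weightedSum μ)) (Finset.mem_univ i)
    rw [h] at h2
    simp [indicatorWeight, hi, seq_eq_zero_of_seq_scale c (p i) hi (eq_zero_of_le_zero h2),
      of_zero]
  · simp [indicatorWeight, hi, of_zero]

/-- For sharp `q`, `a ≤ q` means `qᶜ ∘ a = 0`, a condition that only sees which weights are
positive. -/
theorem IsSharpPartition.isProjectionCover (hp : IsSharpPartition p) (μ : ι → unitInterval) :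
    IsProjectionCover {p : E | IsSharp p} (weightedSum p μ)
      (weightedSum p (indicatorWeight fun i => 0 < μ i)) := by
  refine ⟨hp.isSharp_indicator _, fun q hq => ⟨fun h => ?_, fun h => le_trans' ?_ h⟩⟩
  · rw [IsSharp.le_iff_compl_seq hq] at h ⊢
    exact hp.seq_support_eq_zero μ h
  · refine hp.weightedSum_mono fun i => ?_
    by_cases hi : 0 < μ i
    · rw [indicatorWeight, if_pos hi]
      exact (μ i).2.2
    · rw [indicatorWeight, if_neg hi]
      exact not_lt.1 hi

/-- A sharp element commuting with `⊕ μᵢ pᵢ` commutes with the sums of the `pᵢ` over the level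
sets of `μ`. -/
theorem IsSharpPartition.seqCommute_level (hcov : HasProjectionCoverProperty {p : E | IsSharp p})
    (hp : IsSharpPartition p) {q : E} (hq : IsSharp q) (μ : ι → unitInterval)
    (h : SeqCommute q (weightedSum p μ)) (l : unitInterval) :
    SeqCommute q (weightedSum p (indicatorWeight fun i => μ i = l)) := by
  classical
  -- Induction on the number of positive weights.
  induction hn : (Finset.univ.filter fun i => 0 < μ i).card using Nat.strong_induction_on
    generalizing μ l with
  | _ n ih =>
  have hsupp := hq.seqCommute_cover hcov h (hp.isProjectionCover μ)
  by_cases hl : l = 0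
  · have h1 : (fun i => μ i = l) = fun i => ¬ 0 < μ i := by
      funext i
      rw [hl, unitInterval.pos_iff_ne_zero, not_not]
    rw [h1, hp.weightedSum_indicator_compl]
    exact hsupp.compl_right
  have hl' := unitInterval.pos_iff_ne_zero.2 hl
  by_cases hne : (Finset.univ.filter fun i => μ i = l).Nonempty
  swap
  · have h1 : (indicatorWeight fun i => μ i = l) = fun _ => 0 := by
      funext i
      have : ¬ μ i = l := fun h => hne ⟨i, by simp [h]⟩
      simp [indicatorWeight, this]
    rw [h1, weightedSum_zero]
    exact seqCommute_zero q
  obtain ⟨k, hk⟩ := hne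
  simp only [Finset.mem_filter, Finset.mem_univ, true_and] at hk
  obtain ⟨m, hm, hmin⟩ := Finset.exists_min_image (Finset.univ.filter fun i => 0 < μ i) μ
    ⟨k, by simpa [hk] using hl'⟩
  simp only [Finset.mem_filter, Finset.mem_univ, true_and] at hm hmin
  -- Subtract the least positive weight `μ m` on the support; the truncation keeps zero weights at
  -- zero.
  let ν : ι → unitInterval := fun i => ⟨max 0 ((μ i : ℝ) - μ m), le_max_left _ _,
    max_le zero_le_one ((sub_le_self _ (μ m).2.1).trans (μ i).2.2)⟩
  have hν : ∀ i, 0 < μ i → (ν i : ℝ) = μ i - μ m := fun i hi =>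
    max_eq_right (sub_nonneg.2 (hmin i hi))
  have hν0 : ∀ i, ¬ 0 < μ i → ν i = 0 := fun i hi => by
    have h1 : μ i = 0 := by simpa using hi
    exact Subtype.ext (max_eq_left (by rw [h1]; simpa using (μ m).2.1))
  have hadd := hp.weightedSum_add (μ := fun i => indicatorWeight (fun i => 0 < μ i) i * μ m)
    (ν := ν) (ρ := μ) fun i => by
      by_cases hi : 0 < μ i
      · simp [indicatorWeight, hi, hν i hi]
      · rw [hν0 i hi]
        have h1 : μ i = 0 := by simpa using hi
        simp [indicatorWeight, h1]
  rw [← hp.scale_weightedSum] at hadd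
  have hcν : SeqCommute q (weightedSum p ν) :=
    (hq.seqCommute_scale hsupp (μ m)).sub h hadd
  have hkm : μ m ≤ l := hk ▸ hmin k (hk ▸ hl')
  have hνpos : ∀ i, 0 < ν i ↔ μ m < μ i := fun i => by
    change (0 : ℝ) < max 0 ((μ i : ℝ) - μ m) ↔ (μ m : ℝ) < μ i
    simp
  -- The lowest positive level is the support of `μ` minus that of `ν`. A higher level `l` is the
  -- level `l - μ m` of `ν`, whose support no longer contains `m`.
  rcases hkm.eq_or_lt with hlm | hlm
  · have hsuppν := hq.seqCommute_cover hcov hcν (hp.isProjectionCover ν)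
    refine SeqCommute.sub hsuppν hsupp (hp.weightedSum_add fun i => ?_)
    simp only [indicatorWeight, hνpos, ← hlm]
    by_cases h1 : μ i = μ m
    · simp [h1, hm]
    · by_cases h2 : 0 < μ i
      · simp [h1, h2, lt_of_le_of_ne (hmin i h2) (Ne.symm h1)]
      · simp [h1, h2, (not_lt.1 h2).trans hm.le]
  · have hlm' : (μ m : ℝ) < l := hlm
    let l' : unitInterval := ⟨l - μ m, (sub_pos.2 hlm').le,
      (sub_le_self _ (μ m).2.1).trans l.2.2⟩
    have h1 : (fun i => μ i = l) = fun i => ν i = l' := by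
      funext i
      rw [Subtype.ext_iff, Subtype.ext_iff]
      change _ = ((max 0 ((μ i : ℝ) - μ m) = l - μ m) : Prop)
      refine propext ⟨fun h => ?_, fun h => ?_⟩
      · rw [h, max_eq_right (sub_pos.2 hlm').le]
      · rcases max_choice 0 ((μ i : ℝ) - μ m) with h2 | h2 <;> rw [h2] at h <;> linarith
    rw [h1]
    refine ih _ ?_ ν hcν l' rfl
    rw [← hn]
    refine Finset.card_lt_card (Finset.ssubset_iff_of_subset ?_ |>.2 ⟨m, by simpa using hm, ?_⟩)
    · intro i hi
      simp only [Finset.mem_filter, Finset.mem_univ, true_and, hνpos] at hi ⊢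
      exact hm.trans hi
    · simp [hνpos]

end Partition

theorem IsContextSpectral.exists_isSharpPartition (hE : IsContextSpectral E) (a : E) :
    ∃ (n : ℕ) (p : Fin n → E) (μ : Fin n → unitInterval),
      IsSharpPartition p ∧ weightedSum p μ = a := by
  obtain ⟨n, p, μ, hp, ha⟩ := hE a
  exact ⟨n, p, μ, ⟨hp.sharp, hp.sum_eq_one.sum_fin_eq⟩, weightedSum_eq ha.sum_fin_eq⟩

variable [SequentialEffectAlgebra E]

theorem IsContextSpectral.hasProjectionCoverProperty (hE : IsContextSpectral E) :
    HasProjectionCoverProperty {p : E | IsSharp p} := by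
  intro a
  obtain ⟨n, p, μ, hp, rfl⟩ := hE.exists_isSharpPartition a
  exact ⟨_, hp.isProjectionCover μ⟩

/-- The spectral resolution: `a` is a weighted sum of sharp elements in its bicommutant, and
sharp elements commuting with all of them commute with `a`. -/
theorem IsContextSpectral.exists_spectral_resolution (hE : IsContextSpectral E) (a : E) :
    ∃ (ι : Type) (_ : Fintype ι) (p : ι → E) (μ : ι → unitInterval),
      IsSharpPartition p ∧ weightedSum p μ = a ∧
        (∀ i, p i ∈ bicommutant {p : E | IsSharp p} (fun p a : E => p ⊙ a) {a}) ∧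
        ∀ q, IsSharp q → SeqCommute q a → ∀ i, SeqCommute q (p i) := by
  classical
  obtain ⟨n, p, μ, hp, rfl⟩ := hE.exists_isSharpPartition a
  -- Grouping by level: `ρ = 1` shows that the level sums form a partition, `ρ = id` recovers `a`.
  have key : ∀ ρ : unitInterval → unitInterval,
      ∑ l : Finset.univ.image μ,
        of (scale (ρ l) (weightedSum p (indicatorWeight fun i => μ i = l))) =
        ∑ i, of (scale (ρ (μ i)) (p i)) := by
    intro ρ
    simp only [hp.scale_weightedSum, ← hp.of_weightedSum]
    rw [Finset.sum_comm]
    refine Finset.sum_congr rfl fun i _ => ?_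
    rw [Finset.sum_eq_single
      (⟨μ i, Finset.mem_image_of_mem μ (Finset.mem_univ i)⟩ : Finset.univ.image μ)]
    · simp [indicatorWeight]
    · intro l _ hl
      have : ¬ μ i = l := fun h => hl (Subtype.ext h.symm)
      simp [indicatorWeight, this, of_zero]
    · simp
  have hq : IsSharpPartition
      fun l : Finset.univ.image μ => weightedSum p (indicatorWeight fun i => μ i = l) :=
    ⟨fun l => hp.isSharp_indicator _, by simpa [hp.sum_eq_one] using key fun _ => 1⟩
  have ha := weightedSum_eq ((key id).trans (hp.of_weightedSum μ))
  have hcomm : ∀ q, IsSharp q → SeqCommute q (weightedSum p μ) → ∀ l : Finset.univ.image μ,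
      SeqCommute q (weightedSum p (indicatorWeight fun i => μ i = l)) := fun q hqs h l =>
    hp.seqCommute_level hE.hasProjectionCoverProperty hqs μ h l
  refine ⟨Finset.univ.image μ, inferInstance, _, fun l => l, hq, ha, fun l => ?_, hcomm⟩
  refine mem_bicommutant_iff.2 ⟨hq.sharp l, ?_, fun x hx hxa => (hcomm x hx (hxa _ rfl) l).symm⟩
  rintro _ rfl
  have h := hq.seqCommute_weightedSum (hq.sharp l) (hq.seqCommute l) fun l => l
  exact ha ▸ h

/-- The Boolean algebra is `P({a})`: it contains the spectral elements of `a`, and commuting with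
those suffices to commute with `a`. -/
theorem IsContextSpectral.isBElement (hE : IsContextSpectral E) (a : E) :
    IsBElement {p : E | IsSharp p} (fun p a : E => p ⊙ a) a := by
  refine ⟨_, isBooleanSubalgebra_bicommutant a, fun q hq => ?_⟩
  rw [IsSharp.mem_commutant_iff hq]
  constructor
  · intro h x hx
    rw [IsSharp.mem_commutant_iff hq]
    exact ((mem_bicommutant_iff.1 hx).2.2 q hq (by simpa using h)).symm
  · intro h
    obtain ⟨ι, _, p, μ, hp, rfl, hpa, -⟩ := hE.exists_spectral_resolution a
    exact hp.seqCommute_weightedSum hq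
      (fun i => (IsSharp.mem_commutant_iff hq).1 (h (hpa i))) μ

/-! ### Common refinements and b-comparability -/

section Refinement

variable {ι κ : Type*} [Fintype ι] [Fintype κ] {p : ι → E} {r : κ → E}

theorem IsSharpPartition.sum_seq (hp : IsSharpPartition p) (hr : IsSharpPartition r)
    (μ : ι → unitInterval) :
    ∑ x : ι × κ, of (scale (μ x.1) (p x.1 ⊙ r x.2)) = of (weightedSum p μ) := by
  rw [← hp.of_weightedSum, Fintype.sum_prod_type]
  refine Finset.sum_congr rfl fun i _ => ?_
  have h1 := (isAdditive_seq (p i)).map_sum hr.sum_eq_one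
  rw [seq_one] at h1
  exact (isAdditive_scale (μ i)).map_sum h1

/-- The common refinement of two commuting partitions. -/
theorem IsSharpPartition.refinement (hp : IsSharpPartition p) (hr : IsSharpPartition r)
    (h : ∀ i j, SeqCommute (p i) (r j)) :
    IsSharpPartition (fun x : ι × κ => p x.1 ⊙ r x.2) where
  sharp x := (hp.sharp x.1).seq (hr.sharp x.2) (h x.1 x.2)
  sum_eq_one := by simpa [hp.weightedSum_one] using hp.sum_seq hr fun _ => 1

theorem IsSharpPartition.weightedSum_refinement_fst (hp : IsSharpPartition p)
    (hr : IsSharpPartition r) (μ : ι → unitInterval) :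
    weightedSum (fun x : ι × κ => p x.1 ⊙ r x.2) (fun x => μ x.1) = weightedSum p μ :=
  weightedSum_eq (hp.sum_seq hr μ)

theorem IsSharpPartition.weightedSum_refinement_snd (hp : IsSharpPartition p)
    (hr : IsSharpPartition r) (h : ∀ i j, SeqCommute (p i) (r j)) (ν : κ → unitInterval) :
    weightedSum (fun x : ι × κ => p x.1 ⊙ r x.2) (fun x => ν x.2) = weightedSum r ν := by
  refine weightedSum_eq ?_
  rw [← hr.sum_seq hp ν, ← (Equiv.prodComm ι κ).sum_comp]
  exact Finset.sum_congr rfl fun x _ => by rw [(h x.1 x.2 : p x.1 ⊙ r x.2 = _)]; rfl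

end Refinement

theorem IsContextSpectral.hasBComparability (hE : IsContextSpectral E) :
    HasBComparability {p : E | IsSharp p} (fun p a : E => p ⊙ a) where
  bElement := hE.isBElement
  comparable a b hab := by
    obtain ⟨ι, _, p, μ, hp, ha, hpa, hpc⟩ := hE.exists_spectral_resolution a
    obtain ⟨κ, _, r, ν, hr, hb, hrb, hrc⟩ := hE.exists_spectral_resolution b
    have h : ∀ i j, SeqCommute (p i) (r j) := fun i j =>
      (hp.sharp i).seqCommute_of_compatible (hr.sharp j) (hab _ (hpa i) _ (hrb j))
    have hg := hp.refinement hr h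
    -- Both elements become weighted sums over the same partition, so comparing them reduces to
    -- comparing weights.
    rw [← hp.weightedSum_refinement_fst hr] at ha
    rw [← hp.weightedSum_refinement_snd hr h] at hb
    have hcomm : ∀ q, IsSharp q → (∀ c ∈ ({a, b} : Set E), SeqCommute q c) →
        ∀ x : ι × κ, SeqCommute q (p x.1 ⊙ r x.2) := fun q hq hqc x =>
      (hpc q hq (hqc a (by simp)) x.1).seq (hrc q hq (hqc b (by simp)) x.2)
    -- The cells where the weight of `a` is at most that of `b`.
    let s : ι × κ → Prop := fun x => μ x.1 ≤ ν x.2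
    have hs := hg.isSharp_indicator s
    have hgs : ∀ x : ι × κ, SeqCommute (weightedSum _ (indicatorWeight s)) (p x.1 ⊙ r x.2) :=
      fun x => (hg.seqCommute_weightedSum (hg.sharp x) (hg.seqCommute x) _).symm
    refine ⟨weightedSum _ (indicatorWeight s), mem_bicommutant_iff.2 ⟨hs, ?_, ?_⟩, ?_, ?_⟩
    · rintro c (rfl | rfl)
      · rw [← ha]
        exact hg.seqCommute_weightedSum hs hgs _
      · rw [← hb]
        exact hg.seqCommute_weightedSum hs hgs _
    · exact fun q hq hqc => (hg.seqCommute_weightedSum hq (hcomm q hq hqc) _).symm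
    · rw [← ha, ← hb, hg.indicator_seq, hg.indicator_seq]
      refine hg.weightedSum_mono fun x => ?_
      by_cases hx : s x
      · simp only [indicatorWeight, if_pos hx, one_mul]
        exact hx
      · simp [indicatorWeight, hx]
    · rw [← hg.weightedSum_indicator_compl, ← ha, ← hb, hg.indicator_seq, hg.indicator_seq]
      refine hg.weightedSum_mono fun x => ?_
      by_cases hx : s x
      · simp [indicatorWeight, hx]
      · simpa [indicatorWeight, hx] using (not_le.1 hx).le

end Weighted

end EffectAlgebra

/-- A context-spectral convex sequential effect algebra, with the compressions `a ↦ p ∘ a` for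
sharp `p`, is spectral. -/
theorem mainTheorem6 (E : Type*) [EffectAlgebra E] [ConvexEffectAlgebra E]
    [SequentialEffectAlgebra E] (hE : EffectAlgebra.IsContextSpectral E) :
    EffectAlgebra.IsSpectral {p : E | EffectAlgebra.IsSharp p}
      (fun p a : E => SequentialEffectAlgebra.seq p a) :=
  ⟨EffectAlgebra.isCompressionBase_isSharp, hE.hasProjectionCoverProperty, hE.hasBComparability⟩
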